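/- Fix $t\in\mathbb C$. Let $\overline E_t$ be the smooth compact complex surface obtained as follows (Okamoto's compactified space of initial conditions for the first Painlevé equation $x''=6x^2+t$, $y=x'$). (a) Start with the Hirzebruch surface of degree $2$, glued from four charts $\mathbb C^2_{(q_i,p_i)}$, $i=1,\dots,4$, by $q_1q_2=1,\ p_1=-q_2^2p_2$; $q_3=q_1,\ p_1p_3=1$; $q_4=q_2,\ p_2p_4=1$; $q_3q_4=1,\ p_3=-q_3^2p_4$, where $(q_3,p_3)=(x,y)$. Blow up $(q_4,p_4)=(0,0)$, with new charts $q_4=q^{(1)}p^{(1)},\ p_4=p^{(1)}$ and $q_4=Q^{(1)},\ p_4=Q^{(1)}P^{(1)}$; then blow up $(q^{(1)},p^{(1)})=(0,0)$, with new charts $q^{(1)}=q^{(2)}p^{(2)},\ p^{(1)}=p^{(2)}$ and $q^{(1)}=Q^{(2)},\ p^{(1)}=Q^{(2)}P^{(2)}$. Call the result $S$; put $C=\{Q^{(1)}=0\}\cup\{P^{(2)}=0\}\cong\mathbb P^1$, $U=\mathbb C^2_{(Q^{(1)},P^{(1)})}\cup\mathbb C^2_{(Q^{(2)},P^{(2)})}$,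 and $a=\{(Q^{(2)},P^{(2)})=(0,4)\}\in U\setminus C$. (b) Let $W=\mathbb C^2_{(r,s)}$ with the involution $\sigma(r,s)=(-r,-s)$. The formulas $Q^{(1)}=s^2,\ P^{(1)}=r/s$ and $Q^{(2)}=s/r,\ P^{(2)}=r^2$ define an isomorphism $(W\setminus\{0\})/\sigma\cong U\setminus C$, and $U$ is the minimal resolution of the $A_1$-singularity $0\in W/\sigma$; the points $(r,s)=(\pm2,0)$ lie over $a$. For each sign $\epsilon=\pm$, blow up $W$ at $(2\epsilon,0)$ and then five more times: the charts $(z^{(3)}_\epsilon,w^{(3)}_\epsilon)$, $(Z^{(3)}_\epsilon,W^{(3)}_\epsilon)$ are given by $r=2\epsilon+z^{(3)}_\epsilon w^{(3)}_\epsilon,\ s=w^{(3)}_\epsilon$ and $r=2\epsilon+Z^{(3)}_\epsilon,\ s=Z^{(3)}_\epsilon W^{(3)}_\epsilon$, and for $k=3,\dots,7$ the blowup of $(z^{(k)}_\epsilon,w^{(k)}_\epsilon)=(c_k,0)$, where $c_3=c_4=c_5=0$, $c_6=\epsilon t/2$, $c_7=1/2$, gives the charts $z^{(k)}_\epsilon=c_k+z^{(k+1)}_\epsilon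 w^{(k+1)}_\epsilon,\ w^{(k)}_\epsilon=w^{(k+1)}_\epsilon$ and $z^{(k)}_\epsilon=c_k+Z^{(k+1)}_\epsilon,\ w^{(k)}_\epsilon=Z^{(k+1)}_\epsilon W^{(k+1)}_\epsilon$. Let $X$ be the resulting surface; $\sigma$ lifts to $X$ and exchanges the two sides $\epsilon=\pm$. (c) $\overline E_t$ is the gluing of $S\setminus\{a\}$ and $(X\setminus\{(r,s)=(0,0)\})/\sigma$ along $U\setminus(C\cup\{a\})\cong(W\setminus\{(0,0),(2,0),(-2,0)\})/\sigma$. Let $V_t\subset\overline E_t$ be the union of the nine vertical leaves: $\{p_1=0\}\cup\{p_2=0\}$; the strict transform of $\{q_2=0\}\cup\{q_4=0\}$; the strict transforms of the exceptional curves of the two blowups in (a) (the first is $C$); and the images of the strict transforms of the exceptional curves $\{w^{(k)}_\epsilon=0\}\cup\{Z^{(k)}_\epsilon=0\}$ for $k=3,\dots,7$. Okamoto's space is $E_t=\overline E_t\setminus V_t$. Theorem. For every $t\in\mathbb C$, any function that is holomorphic on $E_t$ and meromorphic on $\overline E_t$ is constant. -/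

import Mathlib

namespace PainleveI

/-- The sign `+1` for the `(z, w)`-side and `-1` for the `(u, v)`-side. -/
def sgn (ε : Bool) : ℂ := if ε then 1 else -1

/-- The coordinate charts of the compact surface. -/
inductive Chart
  /-- the chart `(q_1, p_1)` of the Hirzebruch surface -/
  | q1p1
  /-- the chart `(q_2, p_2)` of the Hirzebruch surface -/
  | q2p2
  /-- the original chart `(x, y) = (q_3, p_3)` -/
  | xy
  /-- the chart `(q_4, p_4)` of the Hirzebruch surface -/
  | q4p4
  /-- the chart `(q^(1), p^(1))` of the first blowup -/
  | qp1
  /-- the chart `(Q^(1), P^(1))` of the first blowup -/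
  | QP1
  /-- the chart `(q^(2), p^(2))` of the second blowup -/
  | qp2
  /-- the chart `(Q^(2), P^(2))` of the second blowup -/
  | QP2
  /-- the chart `(r^(2), s^(2))` of the surface `W` (a double cover with its `(-1)`-curve
  blown down), without the fixed point of the involution -/
  | rs
  /-- `(z^(n+3), w^(n+3))` for `ε = true`, and `(u^(n+3), v^(n+3))` for `ε = false` -/
  | zw (ε : Bool) (n : Fin 6)
  /-- `(Z^(n+3), W^(n+3))` for `ε = true`, and `(U^(n+3), V^(n+3))` for `ε = false` -/
  | ZW (ε : Bool) (n : Fin 6)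
  /-- the symplectic chart `(z, w)` for `ε = true`, and `(u, v)` for `ε = false` -/
  | sympl (ε : Bool)

/-- First coordinate of the centre `(center t ε n, 0)`, in the chart `zw ε n`
(superscript `n + 3`), of the blowup that produces the charts with superscript `n + 4`. -/
noncomputable def center (t : ℂ) (ε : Bool) : Fin 5 → ℂ :=
  ![0, 0, 0, sgn ε * t / 2, 1 / 2]

/-- The part of `ℂ²` on which a chart is a chart of the final surface: the centres of the later
blowups are removed (in every chart in which they are visible), and on the double cover so is the
fixed point `(r, s) = (0, 0)` of the involution `(r, s) ↦ (-r, -s)`. The quotient by the involution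
has an `A_1`-singularity there; its minimal resolution is provided by the charts `QP1` and `QP2`
through `Q^(1) = s ^ 2, P^(1) = r / s` and `Q^(2) = s / r, P^(2) = r ^ 2`, with exceptional curve
`C = {Q^(1) = 0} ∪ {P^(2) = 0}`. -/
def dom (t : ℂ) : Chart → Set (ℂ × ℂ)
  | .q1p1 => Set.univ
  | .q2p2 => Set.univ
  | .xy => Set.univ
  | .q4p4 => {a | a ≠ (0, 0)}
  | .qp1 => {a | a ≠ (0, 0)}
  | .QP1 => Set.univ
  | .qp2 => {a | a ≠ (1 / 4, 0)}
  | .QP2 => {a | a ≠ (0, 4)}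
  | .rs => {a | a ≠ (0, 0) ∧ a ≠ (2, 0) ∧ a ≠ (-2, 0)}
  | .zw ε n => {a | ∀ i : Fin 5, n = i.castSucc → a ≠ (center t ε i, 0)}
  | .ZW ε n => {a | (∀ i : Fin 5, n = i.castSucc → ¬ (a.1 = 0 ∧ a.2 * center t ε i = 1)) ∧
      (n = 0 → a ≠ (-2 * sgn ε, 0) ∧ a ≠ (-4 * sgn ε, 0))}
  | .sympl _ => Set.univ

/-- The coordinate changes between the charts. They are imposed on points of the domains of
the charts only. -/
inductive Glue (t : ℂ) : Chart → ℂ × ℂ → Chart → ℂ × ℂ → Prop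
  -- the Hirzebruch surface of degree 2
  | h12 (q₁ p₁ q₂ p₂ : ℂ) : q₁ * q₂ = 1 → p₁ = -q₂ ^ 2 * p₂ →
      Glue t .q1p1 (q₁, p₁) .q2p2 (q₂, p₂)
  | h31 (x y p₁ : ℂ) : p₁ * y = 1 → Glue t .xy (x, y) .q1p1 (x, p₁)
  | h42 (q₄ p₄ p₂ : ℂ) : p₂ * p₄ = 1 → Glue t .q4p4 (q₄, p₄) .q2p2 (q₄, p₂)
  | h34 (x y q₄ p₄ : ℂ) : x * q₄ = 1 → y = -x ^ 2 * p₄ → Glue t .xy (x, y) .q4p4 (q₄, p₄)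
  -- blowup of `(q_4, p_4) = (0, 0)`
  | b1_lower (q p : ℂ) : Glue t .q4p4 (q * p, p) .qp1 (q, p)
  | b1_upper (Q P : ℂ) : Glue t .q4p4 (Q, Q * P) .QP1 (Q, P)
  | b1_exc (q p P : ℂ) : q * P = 1 → Glue t .qp1 (q, p) .QP1 (q * p, P)
  -- blowup of `(q^(1), p^(1)) = (0, 0)`
  | b2_lower (q p : ℂ) : Glue t .qp1 (q * p, p) .qp2 (q, p)
  | b2_upper (Q P : ℂ) : Glue t .qp1 (Q, Q * P) .QP2 (Q, P)
  | b2_exc (q p P : ℂ) : q * P = 1 → Glue t .qp2 (q, p) .QP2 (q * p, P)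
  -- the two-to-one map from `W` without the fixed point:
  -- `Q^(1) = s ^ 2`, `P^(1) = r / s` and `Q^(2) = s / r`, `P^(2) = r ^ 2`
  | cover1 (r s P : ℂ) : s * P = r → Glue t .rs (r, s) .QP1 (s ^ 2, P)
  | cover2 (r s Q : ℂ) : r * Q = s → Glue t .rs (r, s) .QP2 (Q, r ^ 2)
  -- blowup of `(r^(2), s^(2)) = (2, 0)` and `(-2, 0)`
  | b3_lower (ε : Bool) (z w : ℂ) : Glue t .rs (2 * sgn ε + z * w, w) (.zw ε 0) (z, w)
  | b3_upper (ε : Bool) (Z W : ℂ) : Glue t .rs (2 * sgn ε + Z, Z * W) (.ZW ε 0) (Z, W)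
  -- the five further blowups on each side
  | lower (ε : Bool) (i : Fin 5) (z w : ℂ) :
      Glue t (.zw ε i.castSucc) (center t ε i + z * w, w) (.zw ε i.succ) (z, w)
  | upper (ε : Bool) (i : Fin 5) (Z W : ℂ) :
      Glue t (.zw ε i.castSucc) (center t ε i + Z, Z * W) (.ZW ε i.succ) (Z, W)
  -- the two charts along the exceptional curve of each of the last six blowups
  | exc (ε : Bool) (n : Fin 6) (z w W : ℂ) : z * W = 1 →
      Glue t (.zw ε n) (z, w) (.ZW ε n) (z * w, W)
  -- the involution `σ`, induced by `(r^(2), s^(2)) ↦ (-r^(2), -s^(2))`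
  | sigma_lower (ε : Bool) (n : Fin 6) (z w : ℂ) :
      Glue t (.zw ε n) (z, w) (.zw (!ε) n) ((-1) ^ (n : ℕ) * z, -w)
  | sigma_upper (ε : Bool) (n : Fin 6) (Z W : ℂ) :
      Glue t (.ZW ε n) (Z, W) (.ZW (!ε) n) ((-1) ^ (n + 1 : ℕ) * Z, (-1) ^ (n : ℕ) * W)
  -- the symplectic normalization `z^(8) = -z / 2`, `u^(8) = -u / 2`
  | rescale (ε : Bool) (z w : ℂ) : Glue t (.sympl ε) (z, w) (.zw ε 5) (-z / 2, w)

/-- The compact surface `Ē_t`: the disjoint union of the chart domains modulo the equivalence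
relation generated by the coordinate changes. -/
def Ebar (t : ℂ) : Type :=
  Quot fun a b : (c : Chart) × dom t c => Glue t a.1 a.2 b.1 b.2

/-- The (étale) parametrization of `Ē_t` by a chart. -/
def chartMap (t : ℂ) (c : Chart) (a : dom t c) : Ebar t := Quot.mk _ ⟨c, a⟩

/-- The vertical leaves in each chart. -/
def leaf : Chart → Set (ℂ × ℂ)
  | .q1p1 => {a | a.2 = 0}
  | .q2p2 => {a | a.1 = 0 ∨ a.2 = 0}
  | .xy => ∅
  | .q4p4 => {a | a.1 = 0}
  | .qp1 => {a | a.1 = 0 ∨ a.2 = 0}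
  | .QP1 => {a | a.1 = 0}
  | .qp2 => {a | a.1 = 0 ∨ a.2 = 0}
  | .QP2 => {a | a.1 = 0 ∨ a.2 = 0}
  | .rs => {a | a.2 = 0}
  | .zw _ n => {a | n ≠ Fin.last 5 ∧ a.2 = 0}
  | .ZW _ n => {a | (n ≠ Fin.last 5 ∧ a.1 = 0) ∨ a.2 = 0}
  | .sympl _ => ∅

/-- The union `V_t` of the vertical leaves. -/
def verticalLeaves (t : ℂ) : Set (Ebar t) :=
  {x | ∃ (c : Chart) (a : dom t c), (a : ℂ × ℂ) ∈ leaf c ∧ chartMap t c a = x}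

/-- Okamoto's space `E_t`, the complement of the vertical leaves in `Ē_t`. -/
def E (t : ℂ) : Set (Ebar t) := (verticalLeaves t)ᶜ

/-- The part of a chart that parametrizes points of `E_t`. -/
def domE (t : ℂ) (c : Chart) : Set (ℂ × ℂ) :=
  {a | ∃ ha : a ∈ dom t c, chartMap t c ⟨a, ha⟩ ∈ E t}

open Classical in
/-- A function on `E_t` in the coordinates of a chart; the value off `domE t c` is irrelevant. -/
noncomputable def inChart {t : ℂ} (f : E t → ℂ) (c : Chart) (a : ℂ × ℂ) : ℂ :=
  if h : a ∈ domE t c then f ⟨chartMap t c ⟨a, h.1⟩, h.2⟩ else 0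

/-- `f` is holomorphic on `E_t`: it is holomorphic in the coordinates of every chart. -/
def IsHolomorphicOnE {t : ℂ} (f : E t → ℂ) : Prop :=
  ∀ c : Chart, AnalyticOnNhd ℂ (inChart f c) (domE t c)

/-- `f` is (the restriction to `E_t` of) a meromorphic function on `Ē_t`: near every point of
every chart it is a quotient of two holomorphic functions, whose denominator vanishes identically
on no nonempty open set. -/
def IsMeromorphicOnEbar {t : ℂ} (f : E t → ℂ) : Prop :=
  ∀ c : Chart, ∀ a ∈ dom t c, ∃ N : Set (ℂ × ℂ), IsOpen N ∧ a ∈ N ∧ N ⊆ dom t c ∧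
    ∃ g h : ℂ × ℂ → ℂ, AnalyticOnNhd ℂ g N ∧ AnalyticOnNhd ℂ h N ∧
      N ⊆ closure {b ∈ N | h b ≠ 0} ∧
      ∀ b ∈ N ∩ domE t c, h b * inChart f c b = g b

end PainleveI

/-! Read `f` as an entire function `F` of `(x, y)`. On the double cover `x = s⁻²`, `y = -r s⁻³`, so
with `u = s⁻¹` and weights `2, 3` for `x, y` the weight-`d` part of `F` becomes `u ^ d * p d r`,
where `p d` has degree at most `d / 3` and the parity of `d` (`exists_hasSum_weighted`). Meromorphy
along the leaf `s = 0` leaves only finitely many `p d` (`exists_weighted_polynomial`).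

On the last exceptional curve of the side `ε = +`, `s = w` and `r = 2 + t w⁴/2 + w⁵/2 + ζ w⁶`, and
`F` must stay finite as `w → 0` for every `ζ`. Let `m ≥ 1` be the top weight and `k` the order of `p
m` at `r = 2`. Powers of `ζ` give `m ≤ 6k`; parity gives a zero of the same order at `-2`, so `6k ≤
m`. Thus `m = 6k`, and the next coefficients in `w` force `p (m - 1) = 0` and `p (m - 5) = 0`. The
term `w⁵/2` then has nothing to cancel against, a contradiction (`PainleveI.not_forall_dvd_sum`). So
`F` is constant, and the charts and continuity carry this to all of `E t`. -/

/-! ### The pole along the last exceptional curve -/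

-- Each coefficient of `H (ζ Y)` below degree `m` is a polynomial in `ζ` vanishing on all of `ℂ`, so
-- conditions for all `ζ` separate into one condition per power of `ζ`.
open Polynomial in
theorem Polynomial.X_pow_dvd_coeff_mul_of_forall_eval {H : ℂ[X][X]} {Y : ℂ[X]} {m : ℕ}
    (h : ∀ ζ : ℂ, X ^ m ∣ H.eval (C ζ * Y)) (b : ℕ) : X ^ m ∣ H.coeff b * Y ^ b := by
  rw [X_pow_dvd_iff]
  intro n hn
  have key : (∑ i ∈ Finset.range (H.natDegree + 1),
      C ((H.coeff i * Y ^ i).coeff n) * X ^ i : ℂ[X]) = 0 := by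
    refine Polynomial.funext fun ζ => ?_
    have h1 := (X_pow_dvd_iff.1 (h ζ)) n hn
    rw [eval_eq_sum_range, finsetSum_coeff] at h1
    rw [eval_finsetSum, eval_zero, ← h1]
    refine Finset.sum_congr rfl fun i _ => ?_
    rw [mul_pow, ← C_pow, mul_left_comm, coeff_C_mul]
    rw [eval_mul, eval_C, eval_pow, eval_X, mul_comm]
  by_cases hb : b ≤ H.natDegree
  · have h2 := congrArg (fun q => coeff q b) key
    simp only [finsetSum_coeff, coeff_C_mul, coeff_X_pow, coeff_zero] at h2
    rwa [Finset.sum_eq_single b (fun i _ hi => by simp [hi.symm])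
      (fun hi => absurd (Finset.mem_range.2 (by omega)) hi), if_pos rfl, mul_one] at h2
  · rw [coeff_eq_zero_of_natDegree_lt (not_le.1 hb)]
    simp

-- First-order Taylor expansion suffices, since only coefficients up to degree `5` are used later.
open Polynomial in
theorem Polynomial.exists_comp_X_pow_four_mul (D B : ℂ[X]) :
    ∃ K, D.comp (X ^ 4 * B) = C (D.coeff 0) + C (D.coeff 1) * (X ^ 4 * B) + X ^ 8 * K := by
  refine ⟨B ^ 2 * D.divX.divX.comp (X ^ 4 * B), ?_⟩
  have h0 := divX_mul_X_add D
  have h1 := divX_mul_X_add D.divX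
  rw [coeff_divX] at h1
  conv_lhs => rw [← h0, ← h1]
  simp only [add_comp, mul_comp, X_comp, C_comp]
  ring

open Polynomial in
theorem Polynomial.taylor_map_C_coeff (P A : ℂ[X]) (b : ℕ) :
    (taylor A (P.map C)).coeff b = (hasseDeriv b P).comp A := by
  rw [taylor_coeff, comp, ← eval_map]
  congr 1
  ext1 n
  simp [hasseDeriv_coeff]

open Polynomial in
theorem Polynomial.coeff_sum_X_pow_mul (E : ℕ → ℂ[X]) {m i : ℕ} (hi : i ≤ m) :
    (∑ j ∈ Finset.range (m + 1), X ^ j * E j).coeff i =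
      ∑ j ∈ Finset.range (i + 1), (E j).coeff (i - j) := by
  rw [finsetSum_coeff]
  symm
  rw [← Finset.sum_subset (Finset.range_mono (by omega : i + 1 ≤ m + 1))]
  · refine Finset.sum_congr rfl fun j hj => ?_
    rw [coeff_X_pow_mul', if_pos (by simp at hj; omega)]
  · intro j _ hj
    rw [coeff_X_pow_mul', if_neg (by simp at hj; omega)]

open Polynomial in
/-- A polynomial of definite parity that vanishes to order `k` at `2` also does so at `-2`. -/
theorem Polynomial.two_mul_le_natDegree_of_parity {p : ℂ[X]} {d k : ℕ}
    (hpar : p.comp (-X) = C ((-1) ^ d) * p) (hp : p ≠ 0)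
    (hk : ∀ b < k, (p.comp (X + C 2)).coeff b = 0) : 2 * k ≤ p.natDegree := by
  have h1 : (X - C 2) ^ k ∣ p := X_sub_C_pow_dvd_iff.2 (X_pow_dvd_iff.2 hk)
  have h2 : (X + C 2) ^ k ∣ p := by
    obtain ⟨q, hq⟩ := h1
    have h3 : p = C ((-1) ^ d) * p.comp (-X) := by
      rw [hpar, ← mul_assoc, ← C_mul, ← mul_pow]; simp
    rw [h3, hq, mul_comp, pow_comp]
    have h4 : (X - C 2 : ℂ[X]).comp (-X) = -(X + C 2) := by
      simp only [sub_comp, X_comp, C_comp]; ring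
    rw [h4, neg_pow (X + C 2)]
    exact ⟨C ((-1) ^ d) * ((-1) ^ k * q.comp (-X)), by ring⟩
  have hc : IsCoprime ((X - C 2 : ℂ[X]) ^ k) ((X + C 2) ^ k) := by
    refine IsCoprime.pow ?_
    refine ⟨-C (1 / 4), C (1 / 4), ?_⟩
    have : (-C (1 / 4) * (X - C 2) + C (1 / 4) * (X + C 2) : ℂ[X]) = C (1 / 4 * (2 + 2)) := by
      simp only [C_mul, C_add]; ring
    rw [this]; norm_num
  have h5 := natDegree_le_of_dvd (hc.mul_dvd h1 h2) hp
  rw [((monic_X_sub_C 2).pow k).natDegree_mul ((monic_X_add_C 2).pow k), natDegree_pow,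
    natDegree_pow, natDegree_X_sub_C, natDegree_X_add_C] at h5
  omega

open Polynomial in
theorem Polynomial.coeff_eq_zero_of_parity {p : ℂ[X]} {d n : ℕ}
    (hpar : p.comp (-X) = C ((-1) ^ d) * p) (hdn : Odd (d + n)) : p.coeff n = 0 := by
  have h := congrArg (fun q => coeff q n) hpar
  have hX : (-X : ℂ[X]) = C (-1) * X := by simp
  simp only [coeff_C_mul, hX, comp_C_mul_X_coeff] at h
  have h2 : ((-1 : ℂ) ^ d) * (-1) ^ n = -1 := by rw [← pow_add]; exact hdn.neg_one_pow
  have h3 : ((-1 : ℂ) ^ d) * (-1) ^ d = 1 := by rw [← mul_pow]; simp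
  have h4 : -p.coeff n = p.coeff n := by
    linear_combination (-1 : ℂ) ^ d * h - p.coeff n * h2 + p.coeff n * h3
  exact self_eq_neg.1 h4.symm

open Polynomial in
/-- If all the `p d` have weight at most `d` (where the variable has weight `3`) and the parity
of `d`, the sum of the `w ^ (-d) * p d` has a pole along the last exceptional curve. -/
theorem PainleveI.not_forall_dvd_sum (t : ℂ) (p : ℕ → ℂ[X]) (hdeg : ∀ d, 3 * (p d).natDegree ≤ d)
    (hpar : ∀ d, (p d).comp (-X) = C ((-1) ^ d) * p d) {m : ℕ} (hm : 1 ≤ m) (hpm : p m ≠ 0)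
    (h : ∀ ζ : ℂ, X ^ m ∣ ∑ j ∈ Finset.range (m + 1), X ^ j * (p (m - j)).comp
      (C 2 + (X ^ 4 * (C (t / 2) + C (1 / 2) * X) + C ζ * X ^ 6))) : False := by
  set B : ℂ[X] := C (t / 2) + C (1 / 2) * X with hB
  set P : ℕ → ℂ[X] := fun d => (p d).comp (X + C 2) with hP
  have hP0 : ∀ d, P d = 0 ↔ p d = 0 := fun d => comp_X_add_C_eq_zero_iff
  -- the coefficients of the powers of `ζ`
  have hcoeff : ∀ b i, i + 6 * b < m → i ≤ m → ∑ j ∈ Finset.range (i + 1),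
      ((hasseDeriv b (P (m - j))).comp (X ^ 4 * B)).coeff (i - j) = 0 := by
    intro b i hib him
    -- The outer variable stands for `ζ w ^ 6`; its powers are accompanied by Hasse derivatives at
    -- `w ^ 4 B`.
    set H : ℂ[X][X] := ∑ j ∈ Finset.range (m + 1),
      C (X ^ j) * taylor (X ^ 4 * B) ((P (m - j)).map C) with hH
    have h1 : ∀ ζ : ℂ, X ^ m ∣ H.eval (C ζ * X ^ 6) := by
      intro ζ
      refine (h ζ).trans (dvd_of_eq ?_)
      rw [hH, eval_finsetSum]
      refine Finset.sum_congr rfl fun j _ => ?_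
      rw [eval_mul, eval_C, taylor_eval, eval_map, ← comp, hP, comp_assoc]
      simp only [add_comp, X_comp, C_comp]
      congr 2; ring
    have h2 := X_pow_dvd_coeff_mul_of_forall_eval h1 b
    rw [X_pow_dvd_iff] at h2
    have h3 := h2 (i + 6 * b) hib
    rw [← pow_mul, coeff_mul_X_pow, hH, finsetSum_coeff] at h3
    simp only [coeff_C_mul, taylor_map_C_coeff] at h3
    rwa [coeff_sum_X_pow_mul _ him] at h3
  have hE0 : ∀ b d, ((hasseDeriv b (P d)).comp (X ^ 4 * B)).coeff 0 = (P d).coeff b := by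
    intro b d
    obtain ⟨K, hK⟩ := exists_comp_X_pow_four_mul (hasseDeriv b (P d)) B
    rw [hK]
    simp [mul_coeff_zero, hasseDeriv_coeff]
  have hE : ∀ b d i, 1 ≤ i → i ≤ 5 → ((hasseDeriv b (P d)).comp (X ^ 4 * B)).coeff i =
      (P d).coeff (b + 1) * ((b + 1) * if i < 4 then 0 else B.coeff (i - 4)) := by
    intro b d i h1 h5
    obtain ⟨K, hK⟩ := exists_comp_X_pow_four_mul (hasseDeriv b (P d)) B
    rw [hK, coeff_add, coeff_add, coeff_X_pow_mul', if_neg (by omega), coeff_C_mul,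
      coeff_X_pow_mul', coeff_C, if_neg (by omega), hasseDeriv_coeff]
    have : (1 + b).choose b = b + 1 := by rw [add_comm, Nat.choose_succ_self_right]
    rw [this]
    by_cases h4 : i < 4
    · rw [if_neg (by omega), if_pos h4]; simp
    · rw [if_pos (by omega), if_neg h4, add_comm 1 b]; push_cast; ring
  -- `k` is the order of vanishing of `p m` at `2`.
  obtain ⟨k, hk0, hk⟩ : ∃ k, (P m).coeff k ≠ 0 ∧ ∀ b < k, (P m).coeff b = 0 := by
    refine ⟨(P m).natTrailingDegree, ?_, fun b hb => coeff_eq_zero_of_lt_natTrailingDegree hb⟩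
    exact mt trailingCoeff_eq_zero.1 (mt (hP0 m).1 hpm)
  have hmk : m ≤ 6 * k := by
    by_contra hlt
    have h1 := hcoeff k 0 (by omega) (by omega)
    simp only [zero_add, Finset.sum_range_one, Nat.sub_zero, hE0] at h1
    exact hk0 h1
  have h2k := two_mul_le_natDegree_of_parity (hpar m) hpm hk
  have hdm := hdeg m
  obtain rfl : m = 6 * k := by omega
  have hk1 : 1 ≤ k := by omega
  -- The coefficient of `w ^ 1` makes `p (6 * k - 1)` vanish to order `k` at `2`, hence also at
  -- `-2`: too many zeros for its degree.
  have hp1 : p (6 * k - 1) = 0 := by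
    by_contra hne
    have h1 := two_mul_le_natDegree_of_parity (k := k) (hpar _) hne (fun b hb => by
      have h2 := hcoeff b 1 (by omega) (by omega)
      simp only [Finset.sum_range_succ, Finset.sum_range_zero, Nat.sub_zero, Nat.sub_self, hE0,
        hE b _ 1 le_rfl (by norm_num)] at h2
      simpa using h2)
    have h3 := hdeg (6 * k - 1)
    omega
  have hB1 : B.coeff 1 = 1 / 2 := by simp [hB]
  -- The coefficient of `w ^ 5`. The parameter `t` could enter only through `p (6 * k - 1)`, which
  -- is zero; the factor `1 / 2` is the last blowup centre.
  have h5 : ∀ b < k, (P (6 * k - 5)).coeff b + (P (6 * k)).coeff (b + 1) * ((b + 1) * (1 / 2)) = 0 := by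
    intro b hb
    have h2 := hcoeff b 5 (by omega) (by omega)
    have hP1 : P (6 * k - 1) = 0 := (hP0 _).2 hp1
    simp only [Finset.sum_range_succ, Finset.sum_range_zero, Nat.sub_zero, Nat.sub_self, hE0,
        hE b _ 5 (by norm_num) le_rfl, map_zero, zero_comp,
        hE b _ 3 (by norm_num) (by norm_num), hE b _ 2 (by norm_num) (by norm_num),
        hE b _ 1 (by norm_num) (by norm_num), hP1, Nat.reduceSub, Nat.reduceLT, if_true, if_false,
        hB1, coeff_zero] at h2
    rw [← h2]; ring
  -- Zeros of order `k - 1` at `±2` force the degree to be exactly `2 * k - 2`, which is even,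
  -- whereas the parity is odd.
  have hp5 : p (6 * k - 5) = 0 := by
    by_contra hne
    have h1 := two_mul_le_natDegree_of_parity (k := k - 1) (hpar _) hne (fun b hb => by
      have h2 := h5 b (by omega)
      rw [hk (b + 1) (by omega)] at h2
      simpa using h2)
    have h3 := hdeg (6 * k - 5)
    have h4 : (p (6 * k - 5)).natDegree = 2 * k - 2 := by omega
    have h6 := coeff_eq_zero_of_parity (n := 2 * k - 2) (hpar (6 * k - 5))
      ⟨4 * k - 4, by omega⟩
    rw [← h4] at h6
    exact hne (leadingCoeff_eq_zero.1 h6)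
  have h7 := h5 (k - 1) (by omega)
  rw [(hP0 _).2 hp5, Nat.sub_add_cancel hk1, coeff_zero, zero_add] at h7
  refine hk0 ((mul_eq_zero.1 h7).resolve_right (mul_ne_zero ?_ (by norm_num)))
  have : ((k - 1 : ℕ) : ℂ) + 1 = k := by rw [← Nat.cast_add_one, Nat.sub_add_cancel hk1]
  rw [this]
  exact Nat.cast_ne_zero.2 (by omega)

/-! ### From meromorphy at infinity to polynomials -/

/-- Cauchy's estimate on circles shrinking to `0`. -/
theorem iteratedDeriv_eq_zero_of_isBigO {φ : ℂ → ℂ} (hφ : Differentiable ℂ φ) {d : ℕ}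
    (h : φ =O[nhds 0] fun u => u ^ (d + 1)) : iteratedDeriv d φ 0 = 0 := by
  obtain ⟨C, hC⟩ := h.bound
  obtain ⟨δ, hδ, hball⟩ := Metric.eventually_nhds_iff.1 hC
  have hlim : Filter.Tendsto (fun ρ : ℝ => (d.factorial : ℝ) * C * ρ) (nhdsWithin 0 (Set.Ioi 0))
      (nhds 0) := by
    refine Filter.Tendsto.mono_left ?_ nhdsWithin_le_nhds
    have : Continuous fun ρ : ℝ => (d.factorial : ℝ) * C * ρ := by fun_prop
    simpa using this.tendsto 0
  have hle : ∀ᶠ ρ : ℝ in nhdsWithin 0 (Set.Ioi 0),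
      ‖iteratedDeriv d φ 0‖ ≤ (d.factorial : ℝ) * C * ρ := by
    filter_upwards [Ioo_mem_nhdsGT hδ] with ρ hρ
    have h1 := Complex.norm_iteratedDeriv_le_of_forall_mem_sphere_norm_le d hρ.1
      hφ.diffContOnCl (c := 0) (C := C * ρ ^ (d + 1)) (fun z hz => by
        have h2 : ‖z‖ = ρ := by simpa using hz
        have h3 := hball (y := z) (by simpa [h2] using hρ.2)
        simpa [h2] using h3)
    refine h1.trans (le_of_eq ?_)
    have := hρ.1.ne'
    field_simp
    ring
  exact norm_le_zero_iff.1 (ge_of_tendsto hlim hle)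

/-- Cauchy's estimate on circles of radius `σ⁻¹ → ∞`: a pole of order at most `n` at infinity bounds
the growth by `σ⁻¹ ^ n`. -/
theorem exists_iteratedDeriv_eq_zero_of_meromorphicAt_inv {φ : ℂ → ℂ} (hφ : Differentiable ℂ φ)
    (h : MeromorphicAt (fun s => φ s⁻¹) 0) : ∃ n : ℕ, ∀ d > n, iteratedDeriv d φ 0 = 0 := by
  obtain ⟨n, hn⟩ := h
  refine ⟨n, fun d hd => ?_⟩
  obtain ⟨C, hC⟩ := hn.continuousAt.norm.eventually_lt_const (lt_add_one _) |>.exists_mem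
  obtain ⟨δ, hδ, hball⟩ := Metric.mem_nhds_iff.1 hC.1
  set K := ‖(fun z : ℂ => (z - 0) ^ n • φ z⁻¹) 0‖ + 1
  have hlim : Filter.Tendsto (fun σ : ℝ => (d.factorial : ℝ) * K * σ ^ (d - n))
      (nhdsWithin 0 (Set.Ioi 0)) (nhds 0) := by
    refine Filter.Tendsto.mono_left ?_ nhdsWithin_le_nhds
    have : Continuous fun σ : ℝ => (d.factorial : ℝ) * K * σ ^ (d - n) := by fun_prop
    have h0 : d - n ≠ 0 := by omega
    simpa [h0] using this.tendsto 0
  have hle : ∀ᶠ σ : ℝ in nhdsWithin 0 (Set.Ioi 0),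
      ‖iteratedDeriv d φ 0‖ ≤ (d.factorial : ℝ) * K * σ ^ (d - n) := by
    filter_upwards [Ioo_mem_nhdsGT hδ] with σ hσ
    have hσ0 := hσ.1
    have h1 := Complex.norm_iteratedDeriv_le_of_forall_mem_sphere_norm_le d (inv_pos.2 hσ0)
      hφ.diffContOnCl (c := 0) (C := K / σ ^ n) (fun z hz => by
        have h2 : ‖z‖ = σ⁻¹ := by simpa using hz
        have h3 := hC.2 z⁻¹ (hball (by simpa [h2] using hσ.2))
        rw [le_div_iff₀ (by positivity)]
        simp only [sub_zero, inv_inv, norm_smul, norm_pow, norm_inv, h2] at h3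
        linarith)
    refine h1.trans (le_of_eq ?_)
    have h4 : σ ^ d = σ ^ (d - n) * σ ^ n := by rw [← pow_add]; congr 1; omega
    rw [inv_pow, div_inv_eq_mul, h4]
    field_simp
  exact norm_le_zero_iff.1 (ge_of_tendsto hlim hle)

theorem Polynomial.iteratedDeriv_eval_zero (q : Polynomial ℂ) (d : ℕ) :
    iteratedDeriv d (fun u => q.eval u) 0 = d.factorial * q.coeff d := by
  have h : ∀ n, deriv^[n] (fun u => q.eval u) = fun u => (derivative^[n] q).eval u := by
    intro n
    induction n with
    | zero => rfl
    | succ n ih =>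
      rw [Function.iterate_succ_apply', ih, Function.iterate_succ_apply']
      ext u
      exact Polynomial.deriv _
  rw [iteratedDeriv_eq_iterate, h]
  simp only
  rw [← coeff_zero_eq_eval_zero, coeff_iterate_derivative, zero_add, Nat.descFactorial_self,
    nsmul_eq_mul]

/-- The terms of the series are not assumed symmetric, so monomials are indexed by subsets of `Fin
n` instead of by exponents. -/
theorem FormalMultilinearSeries.apply_prod (P : FormalMultilinearSeries ℂ (ℂ × ℂ) ℂ) (n : ℕ)
    (x y : ℂ) : (P n fun _ => (x, y)) = ∑ s : Finset (Fin n),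
      x ^ s.card * y ^ sᶜ.card * P n (s.piecewise (fun _ => (1, 0)) fun _ => (0, 1)) := by
  have h1 : (fun _ : Fin n => (x, y)) = (fun _ => (x, 0)) + fun _ => (0, y) := by
    ext <;> simp
  rw [h1, ContinuousMultilinearMap.map_add_univ]
  refine Finset.sum_congr rfl fun s _ => ?_
  have h2 : s.piecewise (fun _ : Fin n => ((x, 0) : ℂ × ℂ)) (fun _ => (0, y)) =
      fun i => s.piecewise (fun _ => x) (fun _ => y) i •
        s.piecewise (fun _ => ((1, 0) : ℂ × ℂ)) (fun _ => (0, 1)) i := by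
    ext1 i
    by_cases hi : i ∈ s <;> simp [hi]
  rw [h2, ContinuousMultilinearMap.map_smul_univ, smul_eq_mul, Finset.prod_piecewise]
  simp [Finset.compl_eq_univ_sdiff]

open Polynomial in
/-- The expansion of an entire function in weighted homogeneous parts, with weights `2, 3`. -/
theorem exists_hasSum_weighted {F : ℂ × ℂ → ℂ} (hF : AnalyticOnNhd ℂ F Set.univ) :
    ∃ p : ℕ → ℂ[X], (∀ d, 3 * (p d).natDegree ≤ d) ∧
      (∀ d, (p d).comp (-X) = C ((-1) ^ d) * p d) ∧
      ∀ r d, iteratedDeriv d (fun u => F (u ^ 2, -r * u ^ 3)) 0 = d.factorial * (p d).eval r := by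
  obtain ⟨P, hP⟩ := hF (0, 0) trivial
  let a : (n : ℕ) → Finset (Fin n) → ℂ := fun n s =>
    P n (s.piecewise (fun _ => (1, 0)) fun _ => (0, 1))
  refine ⟨fun d => ∑ n ∈ Finset.range (d + 1), ∑ s : Finset (Fin n),
    if 2 * s.card + 3 * sᶜ.card = d then C (a n s) * (-X) ^ sᶜ.card else 0, fun d => ?_, fun d => ?_,
    fun r d => ?_⟩
  · rw [mul_comm]
    refine (Nat.le_div_iff_mul_le three_pos).1 ?_
    have : (∑ n ∈ Finset.range (d + 1), ∑ s : Finset (Fin n),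
        if 2 * s.card + 3 * sᶜ.card = d then C (a n s) * (-X) ^ sᶜ.card else 0).natDegree ≤ d / 3 := by
      refine natDegree_sum_le_of_forall_le _ _ fun n _ => ?_
      refine natDegree_sum_le_of_forall_le _ _ fun s _ => ?_
      split_ifs with h
      · refine (natDegree_C_mul_le _ _).trans ((natDegree_pow_le).trans ?_)
        rw [natDegree_neg, natDegree_X]
        omega
      · simp
    exact this
  · rw [← coe_compRingHom_apply, map_sum, Finset.mul_sum]
    refine Finset.sum_congr rfl fun n _ => ?_
    rw [map_sum, Finset.mul_sum]
    refine Finset.sum_congr rfl fun s _ => ?_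
    split_ifs with h
    · have h1 : ((-1 : ℂ) ^ d) = (-1) ^ sᶜ.card := by
        rw [← h, pow_add, pow_mul, pow_mul]; norm_num
      rw [coe_compRingHom_apply, h1]
      have h2 : (-X : ℂ[X]) ^ sᶜ.card = C ((-1) ^ sᶜ.card) * X ^ sᶜ.card := by
        rw [neg_pow (X : ℂ[X])]; simp
      simp only [mul_comp, pow_comp, X_comp, C_comp, h2]
      ring
    · simp
  · have hG : Differentiable ℂ fun u : ℂ => F (u ^ 2, -r * u ^ 3) := by
      have h1 : Differentiable ℂ F := fun x => (hF x trivial).differentiableAt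
      fun_prop
    -- Ordinary degree at most `d` captures every monomial of weight `d`, and the remainder is `O(u
    -- ^ (d + 1))`.
    let q : ℂ[X] := ∑ n ∈ Finset.range (d + 1), ∑ s : Finset (Fin n),
      C (a n s * (-r) ^ sᶜ.card) * X ^ (2 * s.card + 3 * sᶜ.card)
    have hq : ∀ u : ℂ, P.partialSum (d + 1) (u ^ 2, -r * u ^ 3) = q.eval u := by
      intro u
      simp only [q, FormalMultilinearSeries.partialSum, eval_finsetSum]
      refine Finset.sum_congr rfl fun n _ => ?_
      rw [FormalMultilinearSeries.apply_prod]
      refine Finset.sum_congr rfl fun s _ => ?_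
      simp only [eval_mul, eval_C, eval_pow, eval_X, a, mul_pow, pow_add, pow_mul]
      ring
    have hlim : Filter.Tendsto (fun u : ℂ => (u ^ 2, -r * u ^ 3)) (nhds 0) (nhds (0, 0)) := by
      have h1 : Continuous fun u : ℂ => (u ^ 2, -r * u ^ 3) := by fun_prop
      simpa using h1.tendsto 0
    have hO1 : (fun u : ℂ => (u ^ 2, -r * u ^ 3)) =O[nhds 0] fun u => u := by
      refine Asymptotics.IsBigO.prod_left ?_ ?_
      · have h1 : (fun u : ℂ => u) =O[nhds 0] fun _ => (1 : ℂ) :=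
          continuousAt_id.isBigO_one ℂ
        simpa [sq] using h1.mul (Asymptotics.isBigO_refl (fun u : ℂ => u) (nhds 0))
      · have h0 : ContinuousAt (fun u : ℂ => -r * u ^ 2) 0 := by fun_prop
        have h1 := h0.isBigO_one ℂ
        have h2 := h1.mul (Asymptotics.isBigO_refl (fun u : ℂ => u) (nhds 0))
        simpa [pow_succ, mul_assoc] using h2
    have hO : (fun u : ℂ => F (u ^ 2, -r * u ^ 3) - q.eval u) =O[nhds 0] fun u => u ^ (d + 1) := by
      have h1 := (hP.isBigO_sub_partialSum_pow (d + 1)).comp_tendsto hlim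
      have h2 := h1.trans ((hO1.norm_left).pow (d + 1))
      refine h2.congr_left fun u => ?_
      have h0 : ((0, 0) : ℂ × ℂ) + (u ^ 2, -r * u ^ 3) = (u ^ 2, -r * u ^ 3) := zero_add _
      simp only [Function.comp, hq, h0]
    have hz := iteratedDeriv_eq_zero_of_isBigO (hG.sub q.differentiable) hO
    rw [iteratedDeriv_sub hG.contDiff.contDiffAt q.differentiable.contDiff.contDiffAt,
      Polynomial.iteratedDeriv_eval_zero, sub_eq_zero] at hz
    rw [hz]
    congr 1
    simp only [q, finsetSum_coeff, eval_finsetSum]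
    refine Finset.sum_congr rfl fun n _ => Finset.sum_congr rfl fun s _ => ?_
    rw [coeff_C_mul, coeff_X_pow]
    split_ifs with h1 h2 h2
    · simp
    · exact absurd h1.symm h2
    · exact absurd h2.symm h1
    · simp

/-- A meromorphic function of two variables is meromorphic on many lines. -/
theorem exists_forall_meromorphicAt_line {N : Set (ℂ × ℂ)} {g h G : ℂ × ℂ → ℂ} {r₀ : ℂ}
    (hN : IsOpen N) (h0 : (r₀, 0) ∈ N) (hg : AnalyticOnNhd ℂ g N) (hh : AnalyticOnNhd ℂ h N)
    (hcl : N ⊆ closure {b ∈ N | h b ≠ 0}) (hG : ∀ r s, (r, s) ∈ N → s ≠ 0 → h (r, s) * G (r, s) = g (r, s)) :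
    ∃ r₁, ∀ᶠ r in nhds r₁, MeromorphicAt (fun s => G (r, s)) 0 := by
  obtain ⟨ε, hε, hball⟩ := Metric.isOpen_iff.1 hN _ h0
  obtain ⟨⟨r₁, s₁⟩, hb, hbN, hne⟩ :=
    mem_closure_iff.1 (hcl h0) _ Metric.isOpen_ball (Metric.mem_ball_self hε)
  rw [← ball_prod_same] at hb hball
  refine ⟨r₁, ?_⟩
  have hcont : ContinuousAt (fun r => h (r, s₁)) r₁ :=
    (hh _ hbN).continuousAt.comp (f := fun r => (r, s₁)) (by fun_prop)
  filter_upwards [hcont.eventually_ne hne, Metric.isOpen_ball.mem_nhds hb.1] with r hr hrb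
  have hmem : ∀ s ∈ Metric.ball (0 : ℂ) ε, (r, s) ∈ N := fun s hs => hball ⟨hrb, hs⟩
  have hhr : AnalyticOnNhd ℂ (fun s => h (r, s)) (Metric.ball 0 ε) := fun s hs =>
    (hh _ (hmem s hs)).comp₂ analyticAt_const analyticAt_id
  have hgr : AnalyticOnNhd ℂ (fun s => g (r, s)) (Metric.ball 0 ε) := fun s hs =>
    (hg _ (hmem s hs)).comp₂ analyticAt_const analyticAt_id
  have h0b : (0 : ℂ) ∈ Metric.ball (0 : ℂ) ε := Metric.mem_ball_self hε
  -- By the identity theorem on the disc: `h (r, ·)` is nonzero at `s₁`.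
  have hnz : ∀ᶠ s in nhdsWithin 0 {0}ᶜ, h (r, s) ≠ 0 := by
    refine (hhr 0 h0b).eventually_eq_zero_or_eventually_ne_zero.resolve_left fun hz => hr ?_
    exact hhr.eqOn_zero_of_preconnected_of_eventuallyEq_zero
      (convex_ball 0 ε).isPreconnected h0b hz hb.2
  refine MeromorphicAt.congr ((hgr 0 h0b).meromorphicAt.div (hhr 0 h0b).meromorphicAt) ?_
  filter_upwards [hnz, self_mem_nhdsWithin,
    mem_nhdsWithin_of_mem_nhds (Metric.isOpen_ball.mem_nhds h0b)] with s hs hs0 hsb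
  simp only [Pi.div_apply]
  rw [← hG r s (hmem s hsb) hs0, mul_div_cancel_left₀ _ hs]

open Polynomial in
/-- An entire function that is meromorphic along the line at infinity of the weighted projective
plane with weights `1, 2, 3` is a polynomial. -/
theorem exists_weighted_polynomial {F : ℂ × ℂ → ℂ} (hF : AnalyticOnNhd ℂ F Set.univ) {r₁ : ℂ}
    (hr : ∀ᶠ r in nhds r₁, MeromorphicAt (fun s : ℂ => F ((s⁻¹) ^ 2, -r * s⁻¹ ^ 3)) 0) :
    ∃ (p : ℕ → ℂ[X]) (l : ℕ), (∀ d, 3 * (p d).natDegree ≤ d) ∧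
      (∀ d, (p d).comp (-X) = C ((-1) ^ d) * p d) ∧ (∀ d > l, p d = 0) ∧
      ∀ r u, F (u ^ 2, -r * u ^ 3) = ∑ d ∈ Finset.range (l + 1), u ^ d * (p d).eval r := by
  obtain ⟨p, hdeg, hpar, hp⟩ := exists_hasSum_weighted hF
  have hG : ∀ r, Differentiable ℂ fun u : ℂ => F (u ^ 2, -r * u ^ 3) := by
    intro r
    have h1 : Differentiable ℂ F := fun x => (hF x trivial).differentiableAt
    fun_prop
  let S : ℕ → Set ℂ := fun l => {r | ∀ d > l, (p d).eval r = 0}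
  have hS : (⋃ l, S l) ∈ nhds r₁ := by
    filter_upwards [hr] with r hr
    obtain ⟨n, hn⟩ := exists_iteratedDeriv_eq_zero_of_meromorphicAt_inv (hG r) hr
    refine Set.mem_iUnion.2 ⟨n, fun d hd => ?_⟩
    have := hn d hd
    rw [hp] at this
    exact (mul_eq_zero.1 this).resolve_left (Nat.cast_ne_zero.2 d.factorial_ne_zero)
  -- The pole order may depend on `r`. Countably many sets `S l` cover a neighbourhood, which is
  -- uncountable, so one bound holds for infinitely many `r`, enough to kill the polynomials `p d`.
  obtain ⟨l, hl⟩ : ∃ l, (S l).Infinite := by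
    by_contra hfin
    simp only [not_exists, Set.not_infinite] at hfin
    have hc : (⋃ l, S l).Countable := Set.countable_iUnion fun l => (hfin l).countable
    obtain ⟨x, hx1, hx2⟩ := (hc.dense_compl ℂ).inter_nhds_nonempty hS
    exact hx1 hx2
  have hp0 : ∀ d > l, p d = 0 := fun d hd =>
    eq_zero_of_infinite_isRoot _ (hl.mono fun r (hr : r ∈ S l) => hr d hd)
  refine ⟨p, l, hdeg, hpar, hp0, fun r u => ?_⟩
  have h1 := Complex.hasSum_taylorSeries_of_entire (hG r) 0 u
  have h3 : (fun d : ℕ => (d.factorial : ℂ)⁻¹ • (u - 0) ^ d •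
      iteratedDeriv d (fun u => F (u ^ 2, -r * u ^ 3)) 0) = fun d => u ^ d * (p d).eval r := by
    ext d
    rw [hp]
    have : (d.factorial : ℂ) ≠ 0 := Nat.cast_ne_zero.2 d.factorial_ne_zero
    simp only [sub_zero, smul_eq_mul]
    field_simp
  rw [h3] at h1
  exact h1.unique (hasSum_sum_of_ne_finset_zero fun d hd => by simp [hp0 d (by simpa using hd)])

/-! ### Regularity on the last exceptional curve forces constancy -/

-- If the order `k` of `Q` at `0` were less than `m`, the cofactor `w ^ (m - k) * ψ w` would tend to
-- `0`, although it is nonzero at `0`.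
open Polynomial in
theorem Polynomial.X_pow_dvd_of_eval_eq_pow_mul {Q : ℂ[X]} {m : ℕ} {ψ : ℂ → ℂ}
    (hψ : ContinuousAt ψ 0) (h : ∀ w ≠ 0, Q.eval w = w ^ m * ψ w) : X ^ m ∣ Q := by
  rcases eq_or_ne Q 0 with rfl | hQ
  · exact dvd_zero _
  obtain ⟨q, hq, hnd⟩ := exists_eq_pow_rootMultiplicity_mul_and_not_dvd Q hQ 0
  set k := rootMultiplicity 0 Q
  rw [C_0, sub_zero] at hq hnd
  by_cases hkm : m ≤ k
  · exact hq ▸ (pow_dvd_pow X hkm).mul_right q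
  refine absurd ?_ hnd
  rw [X_dvd_iff, coeff_zero_eq_eval_zero]
  have h1 : Filter.Tendsto (fun w => q.eval w) (nhdsWithin 0 {0}ᶜ) (nhds (q.eval 0)) :=
    q.continuous.continuousAt.tendsto.mono_left nhdsWithin_le_nhds
  have h2 : Filter.Tendsto (fun w => w ^ (m - k) * ψ w) (nhdsWithin 0 {0}ᶜ) (nhds 0) := by
    have h3 : ContinuousAt (fun w => w ^ (m - k) * ψ w) 0 := by fun_prop
    have h4 : m - k ≠ 0 := by omega
    simpa [h4] using h3.tendsto.mono_left (nhdsWithin_le_nhds (s := {0}ᶜ))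
  refine tendsto_nhds_unique (h1.congr' ?_) h2
  filter_upwards [self_mem_nhdsWithin] with w hw
  have h5 := h w hw
  rw [hq, eval_mul, eval_pow, eval_X] at h5
  refine mul_left_cancel₀ (pow_ne_zero k hw) ?_
  rw [h5, ← mul_assoc, ← pow_add]
  congr 2; omega

open Polynomial in
/-- A function that is a polynomial in the original chart and extends to the last exceptional
curve is constant. -/
theorem PainleveI.eq_const_of_continuousAt (t : ℂ) {F : ℂ × ℂ → ℂ} (hF : Continuous F)
    {p : ℕ → ℂ[X]} {l : ℕ} (hdeg : ∀ d, 3 * (p d).natDegree ≤ d)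
    (hpar : ∀ d, (p d).comp (-X) = C ((-1) ^ d) * p d) (hl : ∀ d > l, p d = 0)
    (hFp : ∀ r u, F (u ^ 2, -r * u ^ 3) = ∑ d ∈ Finset.range (l + 1), u ^ d * (p d).eval r)
    {ψ : ℂ → ℂ → ℂ} (hψ : ∀ ζ, ContinuousAt (ψ ζ) 0)
    (hFψ : ∀ ζ w, w ≠ 0 →
      F (w⁻¹ ^ 2, -(2 + (w ^ 4 * (t / 2 + 1 / 2 * w) + ζ * w ^ 6)) * w⁻¹ ^ 3) = ψ ζ w) :
    ∃ k, ∀ a, F a = k := by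
  have hp : ∀ m ≥ 1, p m = 0 := by
    by_contra! hex
    obtain ⟨m, ⟨hm1, hm⟩, hmax⟩ : ∃ m, (1 ≤ m ∧ p m ≠ 0) ∧ ∀ d > m, p d = 0 := by
      classical
      obtain ⟨m₀, h1, h2⟩ := hex
      have hle : ∀ d, p d ≠ 0 → d ≤ l := fun d hd => not_lt.1 fun h => hd (hl d h)
      refine ⟨Nat.findGreatest (fun d => 1 ≤ d ∧ p d ≠ 0) l,
        Nat.findGreatest_spec (P := fun d => 1 ≤ d ∧ p d ≠ 0) (hle _ h2) ⟨h1, h2⟩, fun d hd => ?_⟩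
      by_contra hne
      exact Nat.findGreatest_is_greatest hd (hle d hne) ⟨by omega, hne⟩
    refine not_forall_dvd_sum t p hdeg hpar hm1 hm fun ζ => ?_
    refine X_pow_dvd_of_eval_eq_pow_mul (hψ ζ) fun w hw => ?_
    rw [← hFψ ζ w hw, hFp]
    set R := 2 + (w ^ 4 * (t / 2 + 1 / 2 * w) + ζ * w ^ 6) with hR
    have hsum : ∑ d ∈ Finset.range (l + 1), w⁻¹ ^ d * (p d).eval R =
        ∑ d ∈ Finset.range (m + 1), w⁻¹ ^ d * (p d).eval R := by
      have hml : m ≤ l := not_lt.1 fun h => hm (hl m h)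
      refine (Finset.sum_subset (Finset.range_mono (by omega)) fun d _ hd => ?_).symm
      rw [hmax d (by simpa using hd)]; simp
    rw [hsum, ← Finset.sum_range_reflect, Finset.mul_sum, eval_finsetSum]
    refine Finset.sum_congr rfl fun j hj => ?_
    have hjm : j ≤ m := by simpa [Nat.lt_succ_iff] using hj
    have h1 : m + 1 - 1 - j = m - j := by omega
    have h2 : w ^ m = w ^ j * w ^ (m - j) := by rw [← pow_add]; congr 1; omega
    rw [h1, h2, eval_mul, eval_pow, eval_X, eval_comp]
    simp only [eval_add, eval_mul, eval_C, eval_pow, eval_X]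
    rw [← hR, inv_pow]
    have := pow_ne_zero (m - j) hw
    field_simp
    rw [Nat.sub_sub_self hjm]
  have h0 : ∀ r u, F (u ^ 2, -r * u ^ 3) = (p 0).coeff 0 := by
    intro r u
    rw [hFp, Finset.sum_eq_single 0 (fun d _ hd => by simp [hp d (Nat.one_le_iff_ne_zero.2 hd)])
      (fun h => by simp at h), pow_zero, one_mul,
      eq_C_of_natDegree_le_zero (by have := hdeg 0; omega : (p 0).natDegree ≤ 0)]
    simp
  refine ⟨(p 0).coeff 0, fun a => ?_⟩
  have hcl : IsClosed {a | F a = (p 0).coeff 0} := isClosed_eq hF continuous_const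
  -- The parametrization `(u ^ 2, -r * u ^ 3)` reaches every point with `x ≠ 0`; the rest follows by
  -- continuity.
  have hd : Dense {a : ℂ × ℂ | a.1 ≠ 0} := by
    have h1 : Dense ({0}ᶜ ×ˢ Set.univ : Set (ℂ × ℂ)) := (dense_compl_singleton 0).prod dense_univ
    exact h1.mono fun a ha => ha.1
  refine (hcl.closure_subset_iff.2 ?_) (hd a)
  rintro ⟨x, y⟩ hx
  obtain ⟨u, rfl⟩ : ∃ u, x = u ^ 2 := (IsAlgClosed.exists_pow_nat_eq x two_pos).imp fun _ h => h.symm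
  have hu : u ≠ 0 := fun h => hx (by simp [h])
  have h1 := h0 (-y / u ^ 3) u
  have h2 : -(-y / u ^ 3) * u ^ 3 = y := by field_simp
  rwa [h2] at h1

/-! ### Leaves and functions in the charts -/

namespace PainleveI

/-- This makes the leaves descend to the quotient, so membership in `E t` can be tested in any
single chart. -/
theorem Glue.mem_leaf_iff {t : ℂ} {c c' : Chart} {a a' : ℂ × ℂ} (hg : Glue t c a c' a')
    (ha : a ∈ dom t c) (ha' : a' ∈ dom t c') : a ∈ leaf c ↔ a' ∈ leaf c' := by
  cases hg with
  | h12 q₁ p₁ q₂ p₂ h1 h2 =>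
    have : q₂ ≠ 0 := right_ne_zero_of_mul_eq_one h1
    simp [leaf, h2, this]
  | h31 x y p₁ h =>
    have : p₁ ≠ 0 := left_ne_zero_of_mul_eq_one h
    simp [leaf, this]
  | h42 q₄ p₄ p₂ h =>
    have : p₂ ≠ 0 := left_ne_zero_of_mul_eq_one h
    simp [leaf, this]
  | h34 x y q₄ p₄ h1 h2 =>
    have : q₄ ≠ 0 := right_ne_zero_of_mul_eq_one h1
    simp [leaf, this]
  | b1_exc q p P h =>
    have : q ≠ 0 := left_ne_zero_of_mul_eq_one h
    simp [leaf, this]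
  | b2_exc q p P h =>
    have h1 : q ≠ 0 := left_ne_zero_of_mul_eq_one h
    have h2 : P ≠ 0 := right_ne_zero_of_mul_eq_one h
    simp [leaf, h1, h2]
  | cover1 r s P h => simp [leaf]
  | cover2 r s Q h => simp [leaf, ← h, or_comm]
  | b3_lower ε z w => simp [leaf]
  | b3_upper ε Z W => simp [leaf]
  | lower ε i z w =>
    -- A point with `w = 0` would lie over the removed centre of the blowup.
    have h1 : w = 0 → False := by
      rintro rfl
      exact ha i rfl (by simp)
    simp only [leaf, Set.mem_ofPred_eq]
    exact ⟨fun h => (h1 h.2).elim, fun h => (h1 h.2).elim⟩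
  | upper ε i Z W =>
    have h1 : Z ≠ 0 := by
      rintro rfl
      exact ha i rfl (by simp)
    have h2 : i.castSucc ≠ 5 := Fin.castSucc_ne_last i
    simp [leaf, h1, h2]
  | exc ε n z w W h =>
    have h1 : z ≠ 0 := left_ne_zero_of_mul_eq_one h
    have h2 : W ≠ 0 := right_ne_zero_of_mul_eq_one h
    simp [leaf, h1, h2]
  | _ => simp [leaf]

theorem chartMap_mem_E_iff {t : ℂ} {c : Chart} (a : dom t c) :
    chartMap t c a ∈ E t ↔ (a : ℂ × ℂ) ∉ leaf c := by
  let L : Ebar t → Prop := Quot.lift (fun x => (x.2 : ℂ × ℂ) ∈ leaf x.1)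
    fun x y h => propext (h.mem_leaf_iff x.2.2 y.2.2)
  refine not_congr ⟨?_, fun h => ⟨c, a, h, rfl⟩⟩
  rintro ⟨c', a', ha', heq⟩
  have h1 : L (chartMap t c' a') := ha'
  rw [heq] at h1
  exact h1

theorem mem_domE_iff {t : ℂ} {c : Chart} {a : ℂ × ℂ} :
    a ∈ domE t c ↔ a ∈ dom t c ∧ a ∉ leaf c :=
  ⟨fun ⟨h1, h2⟩ => ⟨h1, (chartMap_mem_E_iff _).1 h2⟩,
    fun ⟨h1, h2⟩ => ⟨h1, (chartMap_mem_E_iff _).2 h2⟩⟩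

theorem domE_xy (t : ℂ) : domE t .xy = Set.univ :=
  Set.eq_univ_of_forall fun _ => mem_domE_iff.2 ⟨trivial, fun h => h⟩

theorem domE_sympl (t : ℂ) (ε : Bool) : domE t (.sympl ε) = Set.univ :=
  Set.eq_univ_of_forall fun _ => mem_domE_iff.2 ⟨trivial, fun h => h⟩

variable {t : ℂ} (f : E t → ℂ)

/-- On the leaves both sides take the default value `0`, so no membership in `E t` is needed. -/
theorem inChart_eq_of_glue {c c' : Chart} {a a' : ℂ × ℂ} (hg : Glue t c a c' a')
    (ha : a ∈ dom t c) (ha' : a' ∈ dom t c') : inChart f c a = inChart f c' a' := by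
  have hiff : a ∈ domE t c ↔ a' ∈ domE t c' := by
    rw [mem_domE_iff, mem_domE_iff, hg.mem_leaf_iff ha ha']
    simp [ha, ha']
  have heq : chartMap t c ⟨a, ha⟩ = chartMap t c' ⟨a', ha'⟩ := Quot.sound hg
  unfold inChart
  by_cases h : a ∈ domE t c
  · rw [dif_pos h, dif_pos (hiff.1 h)]
    congr 2
  · rw [dif_neg h, dif_neg (mt hiff.2 h)]

theorem mem_dom_rs {r s : ℂ} (hs : s ≠ 0) : (r, s) ∈ dom t .rs := by
  simp [dom, hs]

theorem mem_dom_zw {ε : Bool} {n : Fin 6} {z w : ℂ} (hw : w ≠ 0) : (z, w) ∈ dom t (.zw ε n) := by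
  simp [dom, hw]

theorem inChart_q4p4 {q p : ℂ} (hq : q ≠ 0) :
    inChart f .q4p4 (q, p) = inChart f .xy (q⁻¹, -q⁻¹ ^ 2 * p) :=
  (inChart_eq_of_glue f (.h34 _ _ q p (inv_mul_cancel₀ hq) rfl) trivial (by simp [dom, hq])).symm

/-- The source of the weights `2` and `3`: `q₄ = s ^ 2` and `p₄ = r * s`. -/
theorem inChart_rs {r s : ℂ} (hs : s ≠ 0) :
    inChart f .rs (r, s) = inChart f .xy (s⁻¹ ^ 2, -r * s⁻¹ ^ 3) := by
  rw [inChart_eq_of_glue f (.cover1 r s (r / s) (by field_simp)) (mem_dom_rs hs) trivial,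
    ← inChart_eq_of_glue f (.b1_upper (s ^ 2) (r / s)) (by simp [dom, hs]) trivial,
    inChart_q4p4 f (pow_ne_zero 2 hs)]
  congr 2
  · rw [inv_pow]
  · field_simp

theorem inChart_zw_zero {ε : Bool} {z w : ℂ} (hw : w ≠ 0) :
    inChart f (.zw ε 0) (z, w) = inChart f .rs (2 * sgn ε + z * w, w) :=
  (inChart_eq_of_glue f (.b3_lower ε z w) (mem_dom_rs hw) (mem_dom_zw hw)).symm

theorem inChart_zw_succ {ε : Bool} (i : Fin 5) {z w : ℂ} (hw : w ≠ 0) :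
    inChart f (.zw ε i.succ) (z, w) = inChart f (.zw ε i.castSucc) (center t ε i + z * w, w) :=
  (inChart_eq_of_glue f (.lower ε i z w) (mem_dom_zw hw) (mem_dom_zw hw)).symm

theorem inChart_sympl (ε : Bool) (z w : ℂ) :
    inChart f (.sympl ε) (z, w) = inChart f (.zw ε 5) (-z / 2, w) := by
  exact inChart_eq_of_glue f (.rescale ε z w) trivial
    fun i hi => absurd hi.symm (Fin.castSucc_ne_last i)

/-- Composing the six blowups, the centres `0, 0, 0, t / 2, 1 / 2` become the Taylor coefficients of
`r` in `w`. -/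
theorem inChart_sympl_true {z w : ℂ} (hw : w ≠ 0) : inChart f (.sympl true) (z, w) =
    inChart f .xy (w⁻¹ ^ 2,
      -(2 + (w ^ 4 * (t / 2 + 1 / 2 * w) + (-z / 2) * w ^ 6)) * w⁻¹ ^ 3) := by
  rw [inChart_sympl]
  refine (inChart_zw_succ f 4 hw).trans <| (inChart_zw_succ f 3 hw).trans <|
    (inChart_zw_succ f 2 hw).trans <| (inChart_zw_succ f 1 hw).trans <|
    (inChart_zw_succ f 0 hw).trans <| (inChart_zw_zero f hw).trans <|
    (inChart_rs f hw).trans ?_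
  congr 3
  simp [center, sgn]
  ring

theorem inChart_zw_eq_const {k : ℂ} (hxy : ∀ a, inChart f .xy a = k) {ε : Bool} {n : Fin 6}
    {z w : ℂ} (hw : w ≠ 0) : inChart f (.zw ε n) (z, w) = k := by
  induction n using Fin.induction generalizing z with
  | zero => rw [inChart_zw_zero f hw, inChart_rs f hw, hxy]
  | succ i ih => rw [inChart_zw_succ f i hw, ih]

/-- A function that is constant on the original chart and on the exceptional curves in the
symplectic charts is constant. -/
theorem inChart_eq_const {k : ℂ} (hxy : ∀ a, inChart f .xy a = k)
    (hsympl : ∀ ε z, inChart f (.sympl ε) (z, 0) = k) (c : Chart) {a : ℂ × ℂ} (ha : a ∈ domE t c) :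
    inChart f c a = k := by
  have hzw : ∀ ε n z w, (z, w) ∉ leaf (.zw ε n) → inChart f (.zw ε n) (z, w) = k := by
    intro ε n z w h
    rcases eq_or_ne w 0 with rfl | hw
    · have hn : n = 5 := by
        by_contra hn
        exact h ⟨hn, rfl⟩
      -- The factor `-2` undoes the symplectic rescaling.
      have h1 := hsympl ε (-2 * z)
      rw [inChart_sympl] at h1
      rw [hn, ← h1]
      congr 2; ring
    · exact inChart_zw_eq_const f hxy hw
  have hq1p1 : ∀ q p, p ≠ 0 → inChart f .q1p1 (q, p) = k := fun q p hp => by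
    rw [← inChart_eq_of_glue f (.h31 q p⁻¹ p (mul_inv_cancel₀ hp)) trivial trivial, hxy]
  have hqp1 : ∀ q p, q ≠ 0 → p ≠ 0 → inChart f .qp1 (q, p) = k := fun q p hq hp => by
    rw [← inChart_eq_of_glue f (.b1_lower q p) (by simp [dom, hp]) (by simp [dom, hp]),
      inChart_q4p4 f (mul_ne_zero hq hp), hxy]
  rw [mem_domE_iff] at ha
  obtain ⟨ha, hl⟩ := ha
  obtain ⟨x, y⟩ := a
  cases c with
  | q1p1 => exact hq1p1 _ _ hl
  | q2p2 =>
    simp only [leaf, Set.mem_ofPred_eq, not_or] at hl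
    rw [← inChart_eq_of_glue f (.h12 x⁻¹ (-x ^ 2 * y) x y (inv_mul_cancel₀ hl.1) rfl)
      trivial trivial]
    exact hq1p1 _ _ (mul_ne_zero (neg_ne_zero.2 (pow_ne_zero 2 hl.1)) hl.2)
  | xy => exact hxy _
  | q4p4 => rw [inChart_q4p4 f hl, hxy]
  | qp1 =>
    simp only [leaf, Set.mem_ofPred_eq, not_or] at hl
    exact hqp1 _ _ hl.1 hl.2
  | QP1 =>
    have hx : x ≠ 0 := hl
    rw [← inChart_eq_of_glue f (.b1_upper x y) (by simp [dom, hx]) ha, inChart_q4p4 f hx, hxy]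
  | qp2 =>
    simp only [leaf, Set.mem_ofPred_eq, not_or] at hl
    rw [← inChart_eq_of_glue f (.b2_lower x y) (by simp [dom, hl.2]) ha]
    exact hqp1 _ _ (mul_ne_zero hl.1 hl.2) hl.2
  | QP2 =>
    simp only [leaf, Set.mem_ofPred_eq, not_or] at hl
    rw [← inChart_eq_of_glue f (.b2_upper x y) (by simp [dom, hl.1]) ha]
    exact hqp1 _ _ hl.1 (mul_ne_zero hl.1 hl.2)
  | rs => rw [inChart_rs f hl, hxy]
  | zw ε n => exact hzw ε n x y hl
  | ZW ε n =>
    simp only [leaf, Set.mem_ofPred_eq, not_or, not_and] at hl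
    have hdom : (y⁻¹, x * y) ∈ dom t (.zw ε n) := by
      intro i hi
      have hx : x ≠ 0 := hl.1 (hi ▸ Fin.castSucc_ne_last i)
      simp [hx, hl.2]
    have h1 := Glue.exc (t := t) ε n y⁻¹ (x * y) y (inv_mul_cancel₀ hl.2)
    have h2 : y⁻¹ * (x * y) = x := by have := hl.2; field_simp
    rw [h2] at h1
    rw [← inChart_eq_of_glue f h1 hdom ha]
    refine hzw _ _ _ _ fun h => ?_
    exact mul_ne_zero (hl.1 h.1) hl.2 h.2
  | sympl ε =>
    rw [inChart_sympl]
    exact hzw _ _ _ _ fun h => h.1 rfl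

end PainleveI

/-! ### The theorem -/

theorem theorem3 (t : ℂ) (f : PainleveI.E t → ℂ)
    (hol : PainleveI.IsHolomorphicOnE f) (mer : PainleveI.IsMeromorphicOnEbar f) :
    ∃ k : ℂ, ∀ P : PainleveI.E t, f P = k := by
  have hF : AnalyticOnNhd ℂ (PainleveI.inChart f .xy) Set.univ := PainleveI.domE_xy t ▸ hol .xy
  have hS : ∀ ε, Continuous (PainleveI.inChart f (.sympl ε)) := fun ε =>
    continuousOn_univ.1 (PainleveI.domE_sympl t ε ▸ (hol (.sympl ε)).continuousOn)
  -- The only use of meromorphy. Any point of `s = 0` other than `r = 0, ±2` would serve.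
  obtain ⟨N, hN, h1N, hND, g, h, hg, hh, hcl, hgh⟩ := mer .rs (1, 0) (by norm_num [PainleveI.dom])
  obtain ⟨r₁, hr⟩ := exists_forall_meromorphicAt_line
    (G := fun a => PainleveI.inChart f .xy (a.2⁻¹ ^ 2, -a.1 * a.2⁻¹ ^ 3)) hN h1N hg hh hcl
    fun r s hrs hs => by
      rw [← hgh (r, s) ⟨hrs, PainleveI.mem_domE_iff.2 ⟨hND hrs, hs⟩⟩, PainleveI.inChart_rs f hs]
  obtain ⟨p, l, hdeg, hpar, hl, hp⟩ := exists_weighted_polynomial hF hr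
  obtain ⟨k, hk⟩ := PainleveI.eq_const_of_continuousAt t (continuousOn_univ.1 hF.continuousOn)
    hdeg hpar hl hp (ψ := fun ζ w => PainleveI.inChart f (.sympl true) (-2 * ζ, w))
    (fun ζ => ((hS true).comp (by fun_prop : Continuous fun w : ℂ => (-2 * ζ, w))).continuousAt)
    fun ζ w hw => by
      rw [PainleveI.inChart_sympl_true f hw]
      congr 5; ring
  refine ⟨k, fun ⟨P, hP⟩ => ?_⟩
  obtain ⟨⟨c, a⟩, rfl⟩ := Quot.exists_rep P
  have ha : (a : ℂ × ℂ) ∈ PainleveI.domE t c := ⟨a.2, hP⟩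
  have hfa : PainleveI.inChart f c a = k := by
    refine PainleveI.inChart_eq_const f hk (fun ε z => ?_) c ha
    have hc : Continuous fun w : ℂ => PainleveI.inChart f (.sympl ε) (z, w) :=
      (hS ε).comp (by fun_prop)
    -- The last exceptional curves `w = 0` are not covered by the `xy` chart; the value there is a
    -- limit from `w ≠ 0`.
    have hcl : IsClosed {w | PainleveI.inChart f (.sympl ε) (z, w) = k} :=
      isClosed_eq hc continuous_const
    refine hcl.closure_subset_iff.2 (fun w hw => ?_) (dense_compl_singleton (0 : ℂ) 0)
    show PainleveI.inChart f (.sympl ε) (z, w) = k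
    rw [PainleveI.inChart_sympl]
    exact PainleveI.inChart_zw_eq_const f hk hw
  rw [← hfa, PainleveI.inChart, dif_pos ha]
  rfl
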